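/- Let $\Omega\subset\mathbb{R}^N$ be a bounded open set, $T>0$, $0<c<1$, $\varepsilon>0$. Put $\Omega_T=\Omega\times(0,T]$ and $$\Gamma_\varepsilon=\{x:\operatorname{dist}(x,\Omega)\le\varepsilon\}\times(-\varepsilon^2,0]\ \cup\ \{x\in\mathbb{R}^N\setminus\Omega:\operatorname{dist}(x,\partial\Omega)\le\varepsilon\}\times(0,T].$$ For each $(x,t)\in\Omega_T$ let $\mathcal{A}(x,t)$ be a compact subset of $B(0,1)\times[-\tfrac c2,\tfrac c2]$ with $(0,0)\in\mathcal{A}(x,t)$, where $B(0,1)$ is the open unit ball of $\mathbb{R}^N$, and let $$\mathcal{A}_\varepsilon(x,t)=\Big\{(x,t)+\Big(\varepsilon y,\ \varepsilon^2\tfrac{1-c}{c}s-\varepsilon^2\tfrac{c+1}{2}\Big):(y,s)\in\mathcal{A}(x,t)\Big\}.$$ A function $u:\Omega_T\cup\Gamma_\varepsilon\to\mathbb{R}$ is said to verify the dynamic programming principle (DPP) with boundary values $F:\Gamma_\varepsilon\to\mathbb{R}$ if $u=F$ in $\Gamma_\varepsilon$ and, for every $(x,t)\in\Omega_T$, $$u(x,t)=\frac12\sup_{(y,s)\in\mathcal{A}_\varepsilon(x,t)}u(y,s)+\frac12\inf_{(y,s)\in\mathcal{A}_\varepsilon(x,t)}u(y,s),$$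 the supremum and the infimum being finite. (i) If $v$ and $u$ verify the DPP with boundary values $H$ and $F$ respectively, and $H\le F$ in $\Gamma_\varepsilon$, then $v\le u$ in $\Omega_T$. (ii) If $u$ verifies the DPP with boundary values $F$, and $F$ is bounded on $\Gamma_\varepsilon$, then $\inf_{\Gamma_\varepsilon}F\le u(x,t)\le\sup_{\Gamma_\varepsilon}F$ for every $(x,t)\in\Omega_T$. -/

import Mathlib

open Set Metric

namespace TugOfWar

/-- The space-time `ℝ^N × ℝ`; the space factor carries the Euclidean norm. -/
abbrev SpaceTime (N : ℕ) : Type := EuclideanSpace ℝ (Fin N) × ℝ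

/-- The parabolic cylinder `Ω_T = Ω × (0, T]`. -/
def cylinder {N : ℕ} (Ω : Set (EuclideanSpace ℝ (Fin N))) (T : ℝ) : Set (SpaceTime N) :=
  Ω ×ˢ Ioc 0 T

/-- `Ω_η = {x : dist(x, Ω) ≤ η}`. -/
def outerNbhd {N : ℕ} (Ω : Set (EuclideanSpace ℝ (Fin N))) (η : ℝ) :
    Set (EuclideanSpace ℝ (Fin N)) :=
  cthickening η Ω

/-- `Θ_η = {x ∉ Ω : dist(x, ∂Ω) ≤ η}`. -/
def lateralStrip {N : ℕ} (Ω : Set (EuclideanSpace ℝ (Fin N))) (η : ℝ) :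
    Set (EuclideanSpace ℝ (Fin N)) :=
  Ωᶜ ∩ cthickening η (frontier Ω)

/-- The parabolic boundary strip `Γ_η = Ω_η × (-η², 0] ∪ Θ_η × (0, T]`. -/
def boundaryStrip {N : ℕ} (Ω : Set (EuclideanSpace ℝ (Fin N))) (T η : ℝ) :
    Set (SpaceTime N) :=
  outerNbhd Ω η ×ˢ Ioc (-η ^ 2) 0 ∪ lateralStrip Ω η ×ˢ Ioc 0 T

/-- Condition on a family of sets `𝒜(x,t)`, `(x,t) ∈ Ω_T`: each `𝒜(x,t)` is a compact subset of
`B(0,1) × [-c/2, c/2]` that contains the origin. -/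
def IsMoveFamily {N : ℕ} (Ω : Set (EuclideanSpace ℝ (Fin N))) (T c : ℝ)
    (A : SpaceTime N → Set (SpaceTime N)) : Prop :=
  ∀ p ∈ cylinder Ω T, IsCompact (A p) ∧
    A p ⊆ ball (0 : EuclideanSpace ℝ (Fin N)) 1 ×ˢ Icc (-(c / 2)) (c / 2) ∧
    ((0 : EuclideanSpace ℝ (Fin N)), (0 : ℝ)) ∈ A p

/-- The set `𝒜_ε(x,t)` of possible movements from `p = (x,t)`:
all points `(x,t) + (ε y, ε² ((1-c)/c) s - ε² (c+1)/2)` with `(y,s) ∈ 𝒜(x,t)`. -/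
def moves {N : ℕ} (A : SpaceTime N → Set (SpaceTime N)) (c ε : ℝ) (p : SpaceTime N) :
    Set (SpaceTime N) :=
  (fun q : SpaceTime N =>
    p + (ε • q.1, ε ^ 2 * ((1 - c) / c) * q.2 - ε ^ 2 * ((c + 1) / 2))) '' A p

/-- `u` verifies the dynamic programming principle in `Ω_T` with boundary values `F` in `Γ_ε`:
`u = F` in `Γ_ε`, and at each point of `Ω_T` the value of `u` is the mean of its supremum and its
infimum over `𝒜_ε(x,t)`, these two being finite. Only the values of `u` in `Ω_T ∪ Γ_ε` and those
of `F` in `Γ_ε` enter. -/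
def VerifiesDPP {N : ℕ} (Ω : Set (EuclideanSpace ℝ (Fin N))) (T c ε : ℝ)
    (A : SpaceTime N → Set (SpaceTime N)) (F u : SpaceTime N → ℝ) : Prop :=
  (∀ p ∈ cylinder Ω T,
    BddAbove (u '' moves A c ε p) ∧ BddBelow (u '' moves A c ε p) ∧
    u p = 1 / 2 * sSup (u '' moves A c ε p) + 1 / 2 * sInf (u '' moves A c ε p)) ∧
  ∀ p ∈ boundaryStrip Ω T ε, u p = F p

end TugOfWar

namespace TugOfWar

variable {N : ℕ} {Ω : Set (EuclideanSpace ℝ (Fin N))} {T c ε : ℝ}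
  {A : SpaceTime N → Set (SpaceTime N)}

/-! Every move goes back in time by at least `c * ε ^ 2`, so the strip is reached after finitely
many moves; this gives `cylinder_induction`. An inequality `v ≤ u` at all moves from a point passes
to the supremum and the infimum, hence to their mean. Constants solve the DPP, so the bounds in (ii)
are comparisons with constants. -/

/-- Each move lowers the time by an amount between `c ε²` and `ε²`. -/
lemma moves_time (hc0 : 0 < c) (hc1 : c < 1) (hA : IsMoveFamily Ω T c A)
    {p q : SpaceTime N} (hp : p ∈ cylinder Ω T) (hq : q ∈ moves A c ε p) :
    p.2 - ε ^ 2 ≤ q.2 ∧ q.2 ≤ p.2 - c * ε ^ 2 := by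
  obtain ⟨r, hr, rfl⟩ := hq
  obtain ⟨h1, h2⟩ := ((hA p hp).2.1 hr).2
  have hk : 0 ≤ ε ^ 2 * ((1 - c) / c) :=
    mul_nonneg (sq_nonneg ε) (div_nonneg (by linarith) hc0.le)
  -- At `s = ± c / 2` the time increments are `-c * ε ^ 2` and `-ε ^ 2`.
  have hkc : ε ^ 2 * ((1 - c) / c) * (c / 2) = ε ^ 2 * ((1 - c) / 2) := by
    field_simp
  have hlow := mul_le_mul_of_nonneg_left h1 hk
  have hupp := mul_le_mul_of_nonneg_left h2 hk
  rw [mul_neg, hkc] at hlow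
  rw [hkc] at hupp
  simp only [Prod.snd_add]
  constructor <;> linarith

lemma dist_moves_lt (hε : 0 < ε) (hA : IsMoveFamily Ω T c A)
    {p q : SpaceTime N} (hp : p ∈ cylinder Ω T) (hq : q ∈ moves A c ε p) :
    dist q.1 p.1 < ε := by
  obtain ⟨r, hr, rfl⟩ := hq
  have h : ‖r.1‖ < 1 := by simpa using ((hA p hp).2.1 hr).1
  simp only [Prod.fst_add, dist_self_add_left, norm_smul, Real.norm_eq_abs, abs_of_pos hε]
  exact mul_lt_of_lt_one_right hε h

/-- A point outside a set is at least as close to some frontier point as to any given point of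
the set. -/
lemma exists_mem_frontier_dist_le {E : Type*} [NormedAddCommGroup E] [NormedSpace ℝ E]
    {s : Set E} {x y : E} (hx : x ∈ s) (hy : y ∉ s) :
    ∃ z ∈ frontier s, dist y z ≤ dist y x := by
  -- The connected segment from `x` to `y` meets both closed sets `closure s` and `closure sᶜ`,
  -- which cover it, so it meets their intersection, the frontier.
  obtain ⟨z, hz, hzs⟩ := isPreconnected_closed_iff.1 (convex_segment x y).isPreconnected
    (closure s) (closure sᶜ) isClosed_closure isClosed_closure
    (fun z _ => (em (z ∈ s)).imp (fun h => subset_closure h) (fun h => subset_closure h))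
    ⟨x, left_mem_segment ℝ x y, subset_closure hx⟩ ⟨y, right_mem_segment ℝ x y, subset_closure hy⟩
  rw [← frontier_eq_closure_inter_closure] at hzs
  refine ⟨z, hzs, ?_⟩
  have h := dist_add_dist_of_mem_segment hz
  rw [dist_comm y z, dist_comm y x]
  linarith [dist_nonneg (x := x) (y := z)]

/-- The moves from a point of the cylinder stay in the cylinder or reach the boundary strip. -/
lemma moves_subset (hε : 0 < ε) (hc0 : 0 < c) (hc1 : c < 1) (hA : IsMoveFamily Ω T c A)
    {p : SpaceTime N} (hp : p ∈ cylinder Ω T) :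
    moves A c ε p ⊆ cylinder Ω T ∪ boundaryStrip Ω T ε := by
  intro q hq
  obtain ⟨h1, h2⟩ := moves_time hc0 hc1 hA hp hq
  have hd := dist_moves_lt hε hA hp hq
  have hpΩ : p.1 ∈ Ω := hp.1
  have ht0 : 0 < p.2 := hp.2.1
  have htT : p.2 ≤ T := hp.2.2
  have hcε : 0 < c * ε ^ 2 := by positivity
  rcases le_or_gt q.2 0 with hq0 | hq0
  -- The strict bound `-ε ^ 2 < q.2` comes from `0 < p.2`.
  · exact Or.inr (Or.inl ⟨mem_cthickening_of_dist_le _ _ _ _ hpΩ hd.le, by linarith, hq0⟩)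
  · have hqT : q.2 ∈ Ioc 0 T := ⟨hq0, by linarith⟩
    by_cases hqΩ : q.1 ∈ Ω
    · exact Or.inl ⟨hqΩ, hqT⟩
    · obtain ⟨z, hz, hqz⟩ := exists_mem_frontier_dist_le hpΩ hqΩ
      exact Or.inr (Or.inr
        ⟨⟨hqΩ, mem_cthickening_of_dist_le _ _ _ _ hz (hqz.trans hd.le)⟩, hqT⟩)

lemma moves_nonempty (hA : IsMoveFamily Ω T c A) {p : SpaceTime N} (hp : p ∈ cylinder Ω T) :
    (moves A c ε p).Nonempty :=
  ⟨_, mem_image_of_mem _ (hA p hp).2.2⟩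

/-- Induction along the moves: a property that holds on the boundary strip, and at every point of
the cylinder all of whose moves have it, holds on the cylinder. -/
lemma cylinder_induction (hε : 0 < ε) (hc0 : 0 < c) (hc1 : c < 1) (hA : IsMoveFamily Ω T c A)
    {P : SpaceTime N → Prop} (hbdry : ∀ p ∈ boundaryStrip Ω T ε, P p)
    (hstep : ∀ p ∈ cylinder Ω T, (∀ q ∈ moves A c ε p, P q) → P p) :
    ∀ p ∈ cylinder Ω T, P p := by
  have hcε : 0 < c * ε ^ 2 := by positivity
  -- Induction on time layers of thickness `c * ε ^ 2`; layer zero is empty.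
  have key : ∀ n : ℕ, ∀ p ∈ cylinder Ω T, p.2 ≤ n * (c * ε ^ 2) → P p := by
    intro n
    induction n with
    | zero =>
      intro p hp hpn
      have : 0 < p.2 := hp.2.1
      norm_num at hpn
      linarith
    | succ n ih =>
      intro p hp hpn
      refine hstep p hp fun q hq => ?_
      rcases moves_subset hε hc0 hc1 hA hp hq with h | h
      · refine ih q h ?_
        have := (moves_time hc0 hc1 hA hp hq).2
        push_cast at hpn
        linarith
      · exact hbdry q h
  intro p hp
  obtain ⟨n, hn⟩ := exists_nat_ge (p.2 / (c * ε ^ 2))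
  exact key n p hp ((div_le_iff₀ hcε).1 hn)

/-- Comparison principle for the dynamic programming principle. -/
lemma VerifiesDPP.le_of_le (hε : 0 < ε) (hc0 : 0 < c) (hc1 : c < 1) (hA : IsMoveFamily Ω T c A)
    {H F v u : SpaceTime N → ℝ} (hv : VerifiesDPP Ω T c ε A H v)
    (hu : VerifiesDPP Ω T c ε A F u) (hHF : ∀ p ∈ boundaryStrip Ω T ε, H p ≤ F p) :
    ∀ p ∈ cylinder Ω T, v p ≤ u p := by
  refine cylinder_induction hε hc0 hc1 hA
    (fun p hp => (hv.2 p hp).trans_le ((hHF p hp).trans_eq (hu.2 p hp).symm)) ?_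
  intro p hp h
  obtain ⟨-, hvb, hve⟩ := hv.1 p hp
  obtain ⟨hua, -, hue⟩ := hu.1 p hp
  have hne := moves_nonempty (ε := ε) hA hp
  have hsup : sSup (v '' moves A c ε p) ≤ sSup (u '' moves A c ε p) := by
    refine csSup_le (hne.image v) (forall_mem_image.2 fun q hq => ?_)
    exact (h q hq).trans (le_csSup hua (mem_image_of_mem u hq))
  have hinf : sInf (v '' moves A c ε p) ≤ sInf (u '' moves A c ε p) := by
    refine le_csInf (hne.image u) (forall_mem_image.2 fun q hq => ?_)
    exact (csInf_le hvb (mem_image_of_mem v hq)).trans (h q hq)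
  linarith

/-- Barriers for (ii). Nonempty move sets matter: over an empty one the real `sSup` and `sInf` would
be 0, not `m`. -/
lemma verifiesDPP_const (hA : IsMoveFamily Ω T c A) (m : ℝ) :
    VerifiesDPP Ω T c ε A (fun _ => m) (fun _ => m) := by
  refine ⟨fun p hp => ?_, fun _ _ => rfl⟩
  rw [(moves_nonempty hA hp).image_const m]
  refine ⟨bddAbove_singleton, bddBelow_singleton, ?_⟩
  rw [csSup_singleton, csInf_singleton]
  ring

end TugOfWar

theorem mainTheorem8 (N : ℕ) (Ω : Set (EuclideanSpace ℝ (Fin N))) (hΩ_open : IsOpen Ω)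
    (hΩ_bdd : Bornology.IsBounded Ω) (T c ε : ℝ) (hT : 0 < T) (hc0 : 0 < c) (hc1 : c < 1)
    (hε : 0 < ε) (A : TugOfWar.SpaceTime N → Set (TugOfWar.SpaceTime N))
    (hA : TugOfWar.IsMoveFamily Ω T c A) :
    (∀ H F v u : TugOfWar.SpaceTime N → ℝ,
      TugOfWar.VerifiesDPP Ω T c ε A H v →
      TugOfWar.VerifiesDPP Ω T c ε A F u →
      (∀ p ∈ TugOfWar.boundaryStrip Ω T ε, H p ≤ F p) →
      ∀ p ∈ TugOfWar.cylinder Ω T, v p ≤ u p) ∧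
    (∀ F u : TugOfWar.SpaceTime N → ℝ,
      BddAbove (F '' TugOfWar.boundaryStrip Ω T ε) →
      BddBelow (F '' TugOfWar.boundaryStrip Ω T ε) →
      TugOfWar.VerifiesDPP Ω T c ε A F u →
      ∀ p ∈ TugOfWar.cylinder Ω T,
        sInf (F '' TugOfWar.boundaryStrip Ω T ε) ≤ u p ∧
          u p ≤ sSup (F '' TugOfWar.boundaryStrip Ω T ε)) := by
  refine ⟨fun H F v u hv hu hHF =>
    TugOfWar.VerifiesDPP.le_of_le hε hc0 hc1 hA hv hu hHF, fun F u hFa hFb hu p hp => ⟨?_, ?_⟩⟩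
  · exact TugOfWar.VerifiesDPP.le_of_le hε hc0 hc1 hA (TugOfWar.verifiesDPP_const hA _) hu
      (fun q hq => csInf_le hFb (mem_image_of_mem F hq)) p hp
  · exact TugOfWar.VerifiesDPP.le_of_le hε hc0 hc1 hA hu (TugOfWar.verifiesDPP_const hA _)
      (fun q hq => le_csSup hFa (mem_image_of_mem F hq)) p hp
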